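/- Setting. Consider the control-affine system $\dot x=f(x)+g(x)u$ with $x\in\mathbb R^n$, $u\in\mathbb R^m$ and locally Lipschitz $f:\mathbb R^n\to\mathbb R^n$, $g:\mathbb R^n\to\mathbb R^{n\times m}$. Let $h:\mathbb R^n\to\mathbb R$ be continuously differentiable, $\mathcal C=\{x: h(x)\ge 0\}$, $L_fh(x)=\frac{\partial h}{\partial x}(x)f(x)$ and $L_gh(x)=\frac{\partial h}{\partial x}(x)g(x)$. A function $\alpha:\mathbb R\to\mathbb R$ is in $\mathcal K^{e}$ if it is continuous, strictly increasing and $\alpha(0)=0$. The function $h$ is an optimal-decay control barrier function (OD-CBF) on $\mathcal C$ if for some $\alpha\in\mathcal K^{e}$ $$\sup_{u\in\mathbb R^m,\ \omega\ge 0}\ \big(L_fh(x)+L_gh(x)u+\omega\,\alpha(h(x))\big)>0\qquad\text{for all }x\in\mathcal C .$$ Given $\alpha\in\mathcal K^{e}$, a function $k_d:\mathbb R^n\to\mathbb R^m$, $\theta_d\ge 0$, a symmetric positive definite $\Gamma\in\mathbb R^{m\times m}$ and $p>0$, the OD-CBF-QP at $x$ is $$\min_{u\in\mathbb R^m,\ \omega\ge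 0}\ \tfrac12 (u-k_d(x))^\top\Gamma(u-k_d(x))+\tfrac12 p(\omega-\theta_d)^2\quad\text{s.t.}\quad L_fh(x)+L_gh(x)u\ge-\omega\,\alpha(h(x)),\quad \omega\ge\theta_d .$$ Proposition. Let $h$ be an OD-CBF on $\mathcal C$ and let $\mathcal E\supseteq\mathcal C$ be a set such that $L_gh(x)\ne 0$ for all $x\in\mathcal E\setminus\mathcal C$. Then: (1) For every $\alpha\in\mathcal K^{e}$ (and all $k_d,\theta_d,\Gamma,p$ as above) and every $x\in\mathcal E$, the OD-CBF-QP at $x$ is feasible, and it has exactly one minimizer. (2) Suppose in addition that $\mathcal C$ is compact, $\theta_d>0$ and $k_d$ is continuous. Let $k:\mathbb R^n\to\mathbb R^m$ and $\theta:\mathbb R^n\to\mathbb R$ be functions such that $(k(x),\theta(x))$ is a minimizer of the OD-CBF-QP at every point $x$ of some neighbourhood of $\mathcal C$ at which it is feasible (if $\mathcal E$ is a neighbourhood of $\mathcal C$, it suffices that this holds on $\mathcal E$). Then $\mathcal C$ is asymptotically stable for $\dot x=f(x)+g(x)k(x)$, that is: every trajectory on any interval $[0,T)$ that starts in $\mathcal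 C$ stays in $\mathcal C$; for each $\varepsilon>0$ there is $\delta>0$ such that every trajectory on any interval $[0,T)$ that starts at distance less than $\delta$ from $\mathcal C$ stays at distance less than $\varepsilon$ from $\mathcal C$; and there is $\delta>0$ such that from every point at distance less than $\delta$ from $\mathcal C$ there is a trajectory on $[0,\infty)$, and the distance to $\mathcal C$ of every such trajectory tends to $0$ as $t\to\infty$. -/

import Mathlib

open Set Filter Topology

/-- `α : ℝ → ℝ` is of extended class `𝒦ᵉ`: continuous, strictly increasing, `α 0 = 0`. -/
structure IsExtendedClassK (α : ℝ → ℝ) : Prop where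
  continuous : Continuous α
  strictMono : StrictMono α
  map_zero : α 0 = 0

/-- The Lie derivative `L_f h (x) = ∂h/∂x (x) · f(x)`. -/
noncomputable def lieDrift {n : ℕ} (h : EuclideanSpace ℝ (Fin n) → ℝ)
    (f : EuclideanSpace ℝ (Fin n) → EuclideanSpace ℝ (Fin n))
    (x : EuclideanSpace ℝ (Fin n)) : ℝ :=
  fderiv ℝ h x (f x)

/-- The Lie derivative `L_g h (x) = ∂h/∂x (x) · g(x)`, a row vector, i.e. a linear form in the
input. The `n × m` matrix `g(x)` is regarded as a linear map `ℝᵐ → ℝⁿ`. -/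
noncomputable def lieInput {n m : ℕ} (h : EuclideanSpace ℝ (Fin n) → ℝ)
    (g : EuclideanSpace ℝ (Fin n) → EuclideanSpace ℝ (Fin m) →L[ℝ] EuclideanSpace ℝ (Fin n))
    (x : EuclideanSpace ℝ (Fin n)) : EuclideanSpace ℝ (Fin m) →L[ℝ] ℝ :=
  (fderiv ℝ h x).comp (g x)

/-- The `0`-superlevel set `C = {x | h x ≥ 0}`. -/
def safeSet {n : ℕ} (h : EuclideanSpace ℝ (Fin n) → ℝ) : Set (EuclideanSpace ℝ (Fin n)) :=
  {x | 0 ≤ h x}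

/-- `h` is an optimal-decay control barrier function for `x' = f x + g x u` on `C = {h ≥ 0}`:
for some `α ∈ 𝒦ᵉ` and all `x ∈ C`,
`sup_{u ∈ ℝᵐ, ω ≥ 0} L_f h x + L_g h x u + ω α (h x) > 0`.
The supremum may be `+∞` and is taken in the extended reals. -/
def IsODCBF {n m : ℕ} (h : EuclideanSpace ℝ (Fin n) → ℝ)
    (f : EuclideanSpace ℝ (Fin n) → EuclideanSpace ℝ (Fin n))
    (g : EuclideanSpace ℝ (Fin n) → EuclideanSpace ℝ (Fin m) →L[ℝ] EuclideanSpace ℝ (Fin n)) :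
    Prop :=
  ∃ α : ℝ → ℝ, IsExtendedClassK α ∧ ∀ x ∈ safeSet h,
    (0 : EReal) < ⨆ (u : EuclideanSpace ℝ (Fin m)) (ω : ℝ) (_ : 0 ≤ ω),
      ((lieDrift h f x + lieInput h g x u + ω * α (h x) : ℝ) : EReal)

/-- The squared weighted norm `‖u‖_Γ ^ 2 = uᵀ Γ u`. -/
noncomputable def weightedSq {m : ℕ} (Γ : Matrix (Fin m) (Fin m) ℝ)
    (u : EuclideanSpace ℝ (Fin m)) : ℝ :=
  ∑ i, ∑ j, u i * Γ i j * u j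

/-- The data of an OD-CBF-QP: the function `α`, the desired controller `kd`, the desired decay
rate `θd`, and the weights `Γ` and `p`. -/
structure ODQPData (n m : ℕ) where
  α : ℝ → ℝ
  kd : EuclideanSpace ℝ (Fin n) → EuclideanSpace ℝ (Fin m)
  θd : ℝ
  Γ : Matrix (Fin m) (Fin m) ℝ
  p : ℝ

/-- The standing requirements on the data: `α ∈ 𝒦ᵉ`, `θd ≥ 0`, `Γ` is symmetric positive definite,
`p > 0`. -/
structure ODQPData.Admissible {n m : ℕ} (d : ODQPData n m) : Prop where
  classK : IsExtendedClassK d.α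
  θd_nonneg : 0 ≤ d.θd
  posDef : d.Γ.PosDef
  p_pos : 0 < d.p

/-- The feasible set, at the state `x`, of the OD-CBF-QP; its elements are pairs `(u, ω)`. -/
def ODQPData.feasibleSet {n m : ℕ} (d : ODQPData n m) (h : EuclideanSpace ℝ (Fin n) → ℝ)
    (f : EuclideanSpace ℝ (Fin n) → EuclideanSpace ℝ (Fin n))
    (g : EuclideanSpace ℝ (Fin n) → EuclideanSpace ℝ (Fin m) →L[ℝ] EuclideanSpace ℝ (Fin n))
    (x : EuclideanSpace ℝ (Fin n)) : Set (EuclideanSpace ℝ (Fin m) × ℝ) :=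
  {q | 0 ≤ q.2 ∧ lieDrift h f x + lieInput h g x q.1 ≥ -(q.2 * d.α (h x)) ∧ q.2 ≥ d.θd}

/-- The cost of the OD-CBF-QP: `½ ‖u - kd x‖_Γ ^ 2 + ½ p (ω - θd) ^ 2`. -/
noncomputable def ODQPData.cost {n m : ℕ} (d : ODQPData n m) (x : EuclideanSpace ℝ (Fin n))
    (q : EuclideanSpace ℝ (Fin m) × ℝ) : ℝ :=
  1 / 2 * weightedSq d.Γ (q.1 - d.kd x) + 1 / 2 * d.p * (q.2 - d.θd) ^ 2

/-- `q = (u, ω)` is a minimizer of the OD-CBF-QP at `x`. -/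
def ODQPData.IsSolution {n m : ℕ} (d : ODQPData n m) (h : EuclideanSpace ℝ (Fin n) → ℝ)
    (f : EuclideanSpace ℝ (Fin n) → EuclideanSpace ℝ (Fin n))
    (g : EuclideanSpace ℝ (Fin n) → EuclideanSpace ℝ (Fin m) →L[ℝ] EuclideanSpace ℝ (Fin n))
    (x : EuclideanSpace ℝ (Fin n)) (q : EuclideanSpace ℝ (Fin m) × ℝ) : Prop :=
  q ∈ d.feasibleSet h f g x ∧ IsMinOn (d.cost x) (d.feasibleSet h f g x) q

/-- `x` solves `x' = F x` on the time interval `J` (one-sided derivatives at end points in `J`). -/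
def IsTrajectoryOn {n : ℕ} (F : EuclideanSpace ℝ (Fin n) → EuclideanSpace ℝ (Fin n))
    (x : ℝ → EuclideanSpace ℝ (Fin n)) (J : Set ℝ) : Prop :=
  ∀ t ∈ J, HasDerivWithinAt x (F (x t)) J t

/-- (Local) asymptotic stability of the set `C` for `x' = F x`, without presupposing that
trajectories are unique: `C` is forward invariant and Lyapunov stable, which is required of every
trajectory however short its time interval, and from each point near `C` there is a trajectory
defined for all `t ≥ 0`, and every such trajectory converges to `C`. -/
structure IsAsymptoticallyStable {n : ℕ}
    (F : EuclideanSpace ℝ (Fin n) → EuclideanSpace ℝ (Fin n))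
    (C : Set (EuclideanSpace ℝ (Fin n))) : Prop where
  invariant : ∀ (T : ℝ) (x : ℝ → EuclideanSpace ℝ (Fin n)),
    IsTrajectoryOn F x (Ico 0 T) → x 0 ∈ C → ∀ t ∈ Ico 0 T, x t ∈ C
  stable : ∀ ε > 0, ∃ δ > 0, ∀ (T : ℝ) (x : ℝ → EuclideanSpace ℝ (Fin n)),
    IsTrajectoryOn F x (Ico 0 T) → x 0 ∈ Metric.thickening δ C →
      ∀ t ∈ Ico 0 T, x t ∈ Metric.thickening ε C
  attractive : ∃ δ > 0, ∀ x₀ ∈ Metric.thickening δ C,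
    (∃ x : ℝ → EuclideanSpace ℝ (Fin n), x 0 = x₀ ∧ IsTrajectoryOn F x (Ici 0)) ∧
    ∀ x : ℝ → EuclideanSpace ℝ (Fin n), x 0 = x₀ → IsTrajectoryOn F x (Ici 0) →
      Tendsto (fun t => Metric.infDist (x t) C) atTop (𝓝 0)

/-!
At every state the quadratic program minimizes a strictly convex coercive quadratic cost over a
closed convex set, so a feasible program has exactly one minimizer. On `C = {h ≥ 0}` there is even
a Slater point (`IsODCBF.exists_barrierValue_pos`): where `h x > 0` a large decay rate makes the
constraint strict, and where `h x = 0` the decay term vanishes and the OD-CBF condition provides an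
input. Off `C` a nonzero `L_g h x` gives feasibility.

Having a fixed Slater point is an open condition on the state, so the minimizer exists on a
neighbourhood of `C`, and there it is continuous in the state
(`ODQPData.Admissible.continuousAt_of_isSolution`). The closed-loop field is therefore only known
to be continuous: `k_d` need not be Lipschitz. Hence trajectories are obtained from Peano's theorem
(`exists_forall_hasDerivWithinAt_of_bounded`), applied to a bounded continuous extension of the
field.

The constraints `h' ≥ -ω α(h)` and `ω ≥ θ_d > 0` give `h' ≥ -θ_d α(h) > 0` wherever `h < 0` near
`C`. So `max (-h) 0` is a Lyapunov function for `C`, and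
`isAsymptoticallyStable_safeSet` concludes: negative levels of `h` are never crossed downwards,
small neighbourhoods of the compact set `C` are separated from their boundaries by such levels, and
below a level `-c` the function `h` grows at least at the rate `-θ_d α(-c)`. No uniqueness of
trajectories is used; invariance of `C` is the limiting case of stability.
-/

/-! ### Peano's existence theorem for bounded continuous vector fields -/

/-- The nodes of the Euler polygon with step `τ` for `x' = F x`, started at `x₀`. -/
noncomputable def eulerNode {E : Type*} [NormedAddCommGroup E] [NormedSpace ℝ E] (F : E → E)
    (x₀ : E) (τ : ℝ) : ℕ → E
  | 0 => x₀
  | i + 1 => eulerNode F x₀ τ i + τ • F (eulerNode F x₀ τ i)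

section Peano

variable {E : Type*} [NormedAddCommGroup E] [NormedSpace ℝ E] {F : E → E} {x₀ : E}

lemma norm_eulerNode_sub_sub_le {τ η : ℝ} (hτ : 0 ≤ τ) (v : E) {p q : ℕ} (hpq : p ≤ q)
    (hv : ∀ i, p ≤ i → i < q → ‖F (eulerNode F x₀ τ i) - v‖ ≤ η) :
    ‖eulerNode F x₀ τ q - eulerNode F x₀ τ p - (q * τ - p * τ) • v‖ ≤ (q * τ - p * τ) * η := by
  induction q, hpq using Nat.le_induction with
  | base => simp
  | succ q hpq ih =>
    have h1 := ih fun i hi hiq => hv i hi (by omega)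
    have h2 := hv q hpq (by omega)
    have h3 : eulerNode F x₀ τ (q + 1) - eulerNode F x₀ τ p - (((q + 1 : ℕ) : ℝ) * τ - p * τ) • v
        = (eulerNode F x₀ τ q - eulerNode F x₀ τ p - (q * τ - p * τ) • v)
          + τ • (F (eulerNode F x₀ τ q) - v) := by
      simp only [eulerNode]
      push_cast
      module
    rw [h3]
    refine (norm_add_le _ _).trans ?_
    rw [norm_smul, Real.norm_of_nonneg hτ]
    push_cast
    nlinarith [mul_le_mul_of_nonneg_left h2 hτ]

lemma norm_eulerNode_sub_le {τ L : ℝ} (hτ : 0 ≤ τ) (hL : ∀ x, ‖F x‖ ≤ L) (p q : ℕ) :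
    ‖eulerNode F x₀ τ q - eulerNode F x₀ τ p‖ ≤ |q * τ - p * τ| * L := by
  wlog hpq : p ≤ q generalizing p q
  · rw [norm_sub_rev, abs_sub_comm]
    exact this q p (by omega)
  have h := norm_eulerNode_sub_sub_le (x₀ := x₀) hτ (0 : E) hpq
    (fun i _ _ => by simpa using hL (eulerNode F x₀ τ i))
  rw [abs_of_nonneg (sub_nonneg.2 (by gcongr))]
  simpa using h

/-- **Peano's existence theorem** for a bounded continuous vector field on a proper space, on the
half-line. A solution is a pointwise limit, along an ultrafilter, of Euler step functions; no
uniform convergence is needed since the difference quotients of the step functions are controlled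
by the modulus of continuity of `F` at a single point. -/
theorem exists_forall_hasDerivWithinAt_of_bounded [ProperSpace E] (hF : Continuous F) {L : ℝ}
    (hL : ∀ x, ‖F x‖ ≤ L) (x₀ : E) :
    ∃ x : ℝ → E, x 0 = x₀ ∧ ∀ t ∈ Ici (0 : ℝ), HasDerivWithinAt x (F (x t)) (Ici 0) t := by
  have hL0 : 0 ≤ L := (norm_nonneg _).trans (hL 0)
  let U : Ultrafilter ℕ := hyperfilter ℕ
  have hU : (U : Filter ℕ) ≤ atTop := Nat.hyperfilter_le_atTop
  let τ : ℕ → ℝ := fun j => 1 / ((j : ℝ) + 1)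
  have hτ : ∀ j, 0 < τ j := fun j => Nat.one_div_pos_of_nat
  have hτ0 : Tendsto τ U (𝓝 0) := tendsto_one_div_add_atTop_nhds_zero_nat.mono_left hU
  let N : ℕ → ℝ → ℕ := fun j t => ⌊t / τ j⌋₊
  let X : ℕ → ℝ → E := fun j t => eulerNode F x₀ (τ j) (N j t)
  have hN1 : ∀ j t, 0 ≤ t → N j t * τ j ≤ t := fun j t ht =>
    (le_div_iff₀ (hτ j)).1 (Nat.floor_le (div_nonneg ht (hτ j).le))
  have hN2 : ∀ j t, t < N j t * τ j + τ j := fun j t => by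
    have := (div_lt_iff₀ (hτ j)).1 (Nat.lt_floor_add_one (t / τ j))
    linarith
  have hNlim : ∀ t, 0 ≤ t → Tendsto (fun j => N j t * τ j) U (𝓝 t) := fun t ht => by
    have h1 : Tendsto (fun j => t - τ j) U (𝓝 t) := by simpa using hτ0.const_sub t
    exact tendsto_of_tendsto_of_tendsto_of_le_of_le h1 tendsto_const_nhds
      (fun j => by have := hN2 j t; simp only; linarith) (fun j => hN1 j t ht)
  have hlim : ∀ t, ∃ y, Tendsto (fun j => X j t) U (𝓝 y) := fun t => by
    have hmem : ∀ j, X j t ∈ Metric.closedBall x₀ (|t| * L) := fun j => by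
      rw [mem_closedBall_iff_norm]
      have h1 := norm_eulerNode_sub_le (x₀ := x₀) (hτ j).le hL 0 (N j t)
      have h2 : |(N j t : ℝ) * τ j| ≤ |t| := by
        rw [abs_of_nonneg (mul_nonneg (Nat.cast_nonneg _) (hτ j).le)]
        rcases le_total 0 t with ht | ht
        · exact (hN1 j t ht).trans (le_abs_self t)
        · have : N j t = 0 := Nat.floor_of_nonpos (div_nonpos_of_nonpos_of_nonneg ht (hτ j).le)
          simp [this]
      refine h1.trans (mul_le_mul_of_nonneg_right ?_ hL0)
      simpa using h2
    obtain ⟨y, -, hy⟩ := (isCompact_closedBall x₀ (|t| * L)).ultrafilter_le_nhds'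
      (U.map fun j => X j t) (mem_map.2 (univ_mem' hmem))
    exact ⟨y, hy⟩
  choose x hx using hlim
  refine ⟨x, ?_, fun t ht => ?_⟩
  · refine tendsto_nhds_unique (hx 0) ?_
    have : ∀ j, X j 0 = x₀ := fun j => by simp [X, N, eulerNode]
    simp only [this]
    exact tendsto_const_nhds
  · rw [hasDerivWithinAt_iff_isLittleO, Asymptotics.isLittleO_iff]
    intro η hη
    obtain ⟨R, hR, hRF⟩ := Metric.continuousAt_iff.1 (hF.continuousAt (x := x t)) η hη
    let ρ := R / (4 * (L + 1))
    have hρ : 0 < ρ := by positivity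
    have hρL : 2 * ρ * L < R / 2 := by
      have : ρ * (4 * (L + 1)) = R := div_mul_cancel₀ _ (by positivity)
      nlinarith
    have key : ∀ a b, 0 ≤ a → a ≤ b → t - ρ ≤ a → b ≤ t + ρ →
        ‖x b - x a - (b - a) • F (x t)‖ ≤ (b - a) * η := by
      intro a b ha hab hat hbt
      have hb := ha.trans hab
      have hl : Tendsto (fun j => ‖X j b - X j a - (N j b * τ j - N j a * τ j) • F (x t)‖) U
          (𝓝 ‖x b - x a - (b - a) • F (x t)‖) :=
        (((hx b).sub (hx a)).sub (((hNlim b hb).sub (hNlim a ha)).smul_const _)).norm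
      have hr : Tendsto (fun j => (N j b * τ j - N j a * τ j) * η) U (𝓝 ((b - a) * η)) :=
        ((hNlim b hb).sub (hNlim a ha)).mul_const η
      refine le_of_tendsto_of_tendsto hl hr ?_
      filter_upwards [hτ0.eventually_lt_const hρ, Metric.tendsto_nhds.1 (hx t) (R / 2) (half_pos hR)]
        with j hj hjx
      refine norm_eulerNode_sub_sub_le (hτ j).le _
        (Nat.floor_mono (div_le_div_of_nonneg_right hab (hτ j).le)) fun i hia hib => ?_
      rw [← dist_eq_norm]
      refine (hRF ?_).le
      have h1 : (N j a : ℝ) * τ j ≤ i * τ j := by gcongr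
      have h2 : (i : ℝ) * τ j ≤ N j b * τ j := by gcongr
      have h3 := hN2 j a
      have h4 := hN1 j b hb
      have h5 := hN1 j t ht
      have h6 := hN2 j t
      have h7 : |(i : ℝ) * τ j - N j t * τ j| ≤ 2 * ρ := by
        rw [abs_le]; constructor <;> linarith
      have h8 := norm_eulerNode_sub_le (x₀ := x₀) (hτ j).le hL (N j t) i
      have h9 := mul_le_mul_of_nonneg_right h7 hL0
      calc dist (eulerNode F x₀ (τ j) i) (x t)
          ≤ dist (eulerNode F x₀ (τ j) i) (X j t) + dist (X j t) (x t) := dist_triangle _ _ _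
        _ < R := by rw [dist_eq_norm]; linarith
    filter_upwards [self_mem_nhdsWithin,
      mem_nhdsWithin_of_mem_nhds (Metric.closedBall_mem_nhds t hρ)] with s hs hst
    rw [Metric.mem_closedBall, Real.dist_eq, abs_le] at hst
    rcases le_total s t with h | h
    · have := key s t hs h (by linarith) (by linarith)
      have e : x s - x t - (s - t) • F (x t) = -(x t - x s - (t - s) • F (x t)) := by module
      rwa [e, norm_neg, Real.norm_of_nonpos (by linarith : s - t ≤ 0), neg_sub, mul_comm η]
    · have := key t s ht h (by linarith) (by linarith)
      rwa [Real.norm_of_nonneg (by linarith : 0 ≤ s - t), mul_comm η]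

end Peano

/-! ### Stability of a superlevel set -/

section Stability

variable {n : ℕ} {h : EuclideanSpace ℝ (Fin n) → ℝ}
  {F : EuclideanSpace ℝ (Fin n) → EuclideanSpace ℝ (Fin n)} {x : ℝ → EuclideanSpace ℝ (Fin n)}

lemma IsTrajectoryOn.mono {J J' : Set ℝ} (hx : IsTrajectoryOn F x J) (hJ : J' ⊆ J) :
    IsTrajectoryOn F x J' :=
  fun t ht => (hx t (hJ ht)).mono hJ

lemma IsTrajectoryOn.continuousOn {J : Set ℝ} (hx : IsTrajectoryOn F x J) : ContinuousOn x J :=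
  fun t ht => (hx t ht).continuousWithinAt

lemma IsTrajectoryOn.comp_hasDerivWithinAt {J : Set ℝ} (hx : IsTrajectoryOn F x J)
    (hh : ContDiff ℝ 1 h) {t : ℝ} (ht : t ∈ J) :
    HasDerivWithinAt (fun s => h (x s)) (fderiv ℝ h (x t) (F (x t))) J t :=
  ((hh.differentiable one_ne_zero).differentiableAt (x := x t)).hasFDerivAt.comp_hasDerivWithinAt t
    (hx t ht)

/-- A trajectory cannot cross a negative level of `h` downwards where `h` increases along the flow
on `{h < 0}`. -/
lemma IsTrajectoryOn.le_of_forall_mem {a b c : ℝ} (hx : IsTrajectoryOn F x (Icc a b))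
    (hh : ContDiff ℝ 1 h) {K : Set (EuclideanSpace ℝ (Fin n))} (hxK : ∀ t ∈ Icc a b, x t ∈ K)
    (hK : ∀ y ∈ K, h y < 0 → 0 < fderiv ℝ h y (F y)) (hc : c < 0) (ha : c ≤ h (x a))
    (hab : a ≤ b) : c ≤ h (x b) := by
  have key := image_le_of_deriv_right_lt_deriv_boundary' (f := fun t => -h (x t))
    (f' := fun t => -fderiv ℝ h (x t) (F (x t))) (a := a) (b := b) (B := fun _ => -c)
    (B' := fun _ => 0) (hh.continuous.comp_continuousOn hx.continuousOn).neg
    (fun t ht => ((hx.comp_hasDerivWithinAt hh (Ico_subset_Icc_self ht)).mono_of_mem_nhdsWithin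
      (Icc_mem_nhdsGE_of_mem ht)).neg) (neg_le_neg ha) continuousOn_const
    (fun t _ => hasDerivWithinAt_const _ _ _)
    (fun t ht heq => by
      have := hK (x t) (hxK t (Ico_subset_Icc_self ht)) (by linarith)
      linarith)
  exact neg_le_neg_iff.1 (key (right_mem_Icc.2 hab))

/-- A trajectory that starts in the `ε`-neighbourhood of `C` above a level `-c` that separates it
from the boundary of that neighbourhood never leaves the neighbourhood. -/
lemma IsTrajectoryOn.mem_thickening {C : Set (EuclideanSpace ℝ (Fin n))} {T ε c : ℝ}
    (hx : IsTrajectoryOn F x (Ico 0 T)) (hh : ContDiff ℝ 1 h)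
    (hpos : ∀ y ∈ Metric.cthickening ε C, h y < 0 → 0 < fderiv ℝ h y (F y)) (hc : 0 < c)
    (hbd : ∀ y ∈ Metric.cthickening ε C, y ∉ Metric.thickening ε C → h y < -c)
    (hx0 : x 0 ∈ Metric.thickening ε C) (hhx0 : -c ≤ h (x 0)) :
    ∀ t ∈ Ico 0 T, x t ∈ Metric.thickening ε C := by
  intro t ht
  by_contra hcon
  have hsub : Icc 0 t ⊆ Ico 0 T := Icc_subset_Ico_right ht.2
  -- The exit times up to `t` form a compact set; `s` is the first of them.
  have hclosed : IsClosed (Icc 0 t ∩ x ⁻¹' (Metric.thickening ε C)ᶜ) :=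
    (hx.continuousOn.mono hsub).preimage_isClosed_of_isClosed isClosed_Icc
      Metric.isOpen_thickening.isClosed_compl
  obtain ⟨s, ⟨hs, hsC⟩, hmin⟩ :=
    (isCompact_Icc.of_isClosed_subset hclosed inter_subset_left).exists_isLeast
      ⟨t, right_mem_Icc.2 ht.1, hcon⟩
  have hs0 : s ≠ 0 := by rintro rfl; exact hsC hx0
  have hbefore : ∀ u ∈ Ico 0 s, x u ∈ Metric.thickening ε C := fun u hu => by
    by_contra hu'
    exact absurd (hmin ⟨⟨hu.1, hu.2.le.trans hs.2⟩, hu'⟩) (not_le.2 hu.2)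
  have hsub' : Icc 0 s ⊆ Ico 0 T := (Icc_subset_Icc_right hs.2).trans hsub
  have hmaps : MapsTo x (Icc 0 s) (Metric.cthickening ε C) := by
    have h1 : MapsTo x (closure (Ico 0 s)) (closure (Metric.thickening ε C)) := by
      refine MapsTo.closure_of_continuousOn hbefore ?_
      rw [closure_Ico hs0.symm]
      exact hx.continuousOn.mono hsub'
    rw [closure_Ico hs0.symm] at h1
    exact h1.mono_right (Metric.closure_thickening_subset_cthickening _ _)
  have h1 := (hx.mono hsub').le_of_forall_mem hh hmaps hpos (neg_lt_zero.2 hc) hhx0 hs.1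
  exact absurd (hbd _ (hmaps (right_mem_Icc.2 hs.1)) hsC) (not_lt.2 h1)

/-- Away from a compact superlevel set, but within bounded distance of it, `h` is bounded away
from `0`. -/
lemma exists_forall_lt_neg_of_notMem_thickening (hh : Continuous h) (hC : IsCompact (safeSet h))
    (r : ℝ) {ε : ℝ} (hε : 0 < ε) :
    ∃ c > 0, ∀ y ∈ Metric.cthickening r (safeSet h), y ∉ Metric.thickening ε (safeSet h) →
      h y < -c := by
  have hK : IsCompact (Metric.cthickening r (safeSet h) \ Metric.thickening ε (safeSet h)) :=
    hC.cthickening.diff Metric.isOpen_thickening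
  obtain ⟨c, hc, hcK⟩ := hK.exists_forall_le' (f := fun y => -h y) hh.neg.continuousOn (a := 0)
    (fun y hy => by
      have : y ∉ safeSet h := fun hyC => hy.2 (Metric.self_subset_thickening hε _ hyC)
      simpa [safeSet] using this)
  refine ⟨c / 2, half_pos hc, fun y hy hy' => ?_⟩
  have := hcK y ⟨hy, hy'⟩
  linarith

/-- The Lyapunov-stability estimate: one `δ` serves all vector fields along which `h` increases
near the set. -/
lemma exists_forall_trajectory_mem_thickening (hh : ContDiff ℝ 1 h) (hC : IsCompact (safeSet h))
    {ε : ℝ} (hε : 0 < ε) :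
    ∃ δ > 0, ∀ (F : EuclideanSpace ℝ (Fin n) → EuclideanSpace ℝ (Fin n)),
      (∀ y ∈ Metric.cthickening ε (safeSet h), h y < 0 → 0 < fderiv ℝ h y (F y)) →
      ∀ (T : ℝ) (x : ℝ → EuclideanSpace ℝ (Fin n)), IsTrajectoryOn F x (Ico 0 T) →
        x 0 ∈ Metric.thickening δ (safeSet h) →
        ∀ t ∈ Ico 0 T, x t ∈ Metric.thickening ε (safeSet h) := by
  obtain ⟨c, hc, hcK⟩ := exists_forall_lt_neg_of_notMem_thickening hh.continuous hC ε hε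
  obtain ⟨δ, hδ, hδsub⟩ := hC.exists_thickening_subset_open (t := {y | -c < h y})
    (isOpen_lt continuous_const hh.continuous)
    (fun y (hy : 0 ≤ h y) => (neg_lt_zero.2 hc).trans_le hy)
  refine ⟨min δ ε, lt_min hδ hε, fun F hF T x hx hx0 => ?_⟩
  exact hx.mem_thickening hh hF hc hcK (Metric.thickening_mono (min_le_right _ _) _ hx0)
    (hδsub (Metric.thickening_mono (min_le_left _ _) _ hx0)).le

/-- A continuous vector field on a compact set extends to a bounded continuous vector field on the
whole space. -/
lemma exists_bounded_continuous_eqOn {K : Set (EuclideanSpace ℝ (Fin n))} (hK : IsCompact K)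
    (hF : ContinuousOn F K) :
    ∃ (G : EuclideanSpace ℝ (Fin n) → EuclideanSpace ℝ (Fin n)) (L : ℝ),
      Continuous G ∧ (∀ y, ‖G y‖ ≤ L) ∧ EqOn G F K := by
  have : CompactSpace K := isCompact_iff_compactSpace.1 hK
  obtain ⟨G, -, hG⟩ := BoundedContinuousFunction.exists_norm_eq_domRestrict_eq hK.isClosed ℝ
    (BoundedContinuousFunction.mkOfCompact ⟨K.domRestrict F, hF.domRestrict⟩)
  exact ⟨G, ‖G‖, G.continuous, G.norm_coe_le_norm, fun y hy => DFunLike.congr_fun hG ⟨y, hy⟩⟩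

/-- If, near the compact set `{h ≥ 0}` and outside it, the derivative of `h` along a continuous
vector field is at least a positive nonincreasing function of `h`, then the set is asymptotically
stable. -/
theorem isAsymptoticallyStable_safeSet (hh : ContDiff ℝ 1 h) (hC : IsCompact (safeSet h))
    {r : ℝ} (hr : 0 < r) (hF : ContinuousOn F (Metric.cthickening r (safeSet h)))
    {φ : ℝ → ℝ} (hφ : Antitone φ) (hφpos : ∀ s < 0, 0 < φ s)
    (hdec : ∀ y ∈ Metric.cthickening r (safeSet h), h y < 0 → φ (h y) ≤ fderiv ℝ h y (F y)) :
    IsAsymptoticallyStable F (safeSet h) := by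
  have hpos : ∀ y ∈ Metric.cthickening r (safeSet h), h y < 0 → 0 < fderiv ℝ h y (F y) :=
    fun y hy hy0 => (hφpos _ hy0).trans_le (hdec y hy hy0)
  have hstable : ∀ ε > 0, ∃ δ > 0, ∀ (T : ℝ) (x : ℝ → EuclideanSpace ℝ (Fin n)),
      IsTrajectoryOn F x (Ico 0 T) → x 0 ∈ Metric.thickening δ (safeSet h) →
      ∀ t ∈ Ico 0 T, x t ∈ Metric.thickening ε (safeSet h) := fun ε hε => by
    obtain ⟨δ, hδ, H⟩ := exists_forall_trajectory_mem_thickening hh hC (lt_min hε hr)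
    exact ⟨δ, hδ, fun T x hx hx0 t ht => Metric.thickening_mono (min_le_left _ _) _
      (H F (fun y hy => hpos y (Metric.cthickening_mono (min_le_right _ _) _ hy)) T x hx hx0 t ht)⟩
  refine ⟨fun T x hx hx0 t ht => ?_, hstable, ?_⟩
  · -- A point in every neighbourhood of the closed set `{h ≥ 0}` belongs to it.
    rw [← hC.isClosed.closure_eq, Metric.closure_eq_iInter_thickening]
    simp only [mem_iInter]
    intro ε hε
    obtain ⟨δ, hδ, H⟩ := hstable ε hε
    exact H T x hx (Metric.self_subset_thickening hδ _ hx0) t ht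
  · obtain ⟨δ, hδ, H⟩ := exists_forall_trajectory_mem_thickening hh hC hr
    have hglobal : ∀ (G : EuclideanSpace ℝ (Fin n) → EuclideanSpace ℝ (Fin n)),
        (∀ y ∈ Metric.cthickening r (safeSet h), h y < 0 → 0 < fderiv ℝ h y (G y)) →
        ∀ x : ℝ → EuclideanSpace ℝ (Fin n), IsTrajectoryOn G x (Ici 0) →
        x 0 ∈ Metric.thickening δ (safeSet h) →
        ∀ t, 0 ≤ t → x t ∈ Metric.cthickening r (safeSet h) := fun G hG x hx hx0 t ht =>
      Metric.thickening_subset_cthickening _ _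
        (H G hG (t + 1) x (hx.mono Ico_subset_Ici_self) hx0 t ⟨ht, lt_add_one t⟩)
    refine ⟨δ, hδ, fun x₀ hx₀ => ⟨?_, ?_⟩⟩
    · obtain ⟨G, L, hGc, hGL, hGF⟩ := exists_bounded_continuous_eqOn hC.cthickening hF
      obtain ⟨x, hx0, hx⟩ := exists_forall_hasDerivWithinAt_of_bounded hGc hGL x₀
      -- The trajectory of the extended field stays where it agrees with `F`.
      have hmem := hglobal G (fun y hy hy0 => by rw [hGF hy]; exact hpos y hy hy0) x hx
        (hx0 ▸ hx₀)
      exact ⟨x, hx0, fun t ht => by rw [← hGF (hmem t ht)]; exact hx t ht⟩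
    · rintro x rfl hx
      have hmem := hglobal F hpos x hx hx₀
      rw [Metric.tendsto_nhds]
      intro ε hε
      obtain ⟨c, hc, hcK⟩ := exists_forall_lt_neg_of_notMem_thickening hh.continuous hC r hε
      -- Below the level `-c` the function `h` grows at least at the rate `φ (-c) > 0`.
      have hreach : ∃ t₀, 0 ≤ t₀ ∧ -c ≤ h (x t₀) := by
        by_contra! hcon
        have hκ := hφpos (-c) (neg_lt_zero.2 hc)
        have hd : ∀ t ∈ interior (Ici (0 : ℝ)),
            HasDerivAt (fun s => h (x s)) (fderiv ℝ h (x t) (F (x t))) t := fun t ht =>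
          (hx.comp_hasDerivWithinAt hh (interior_subset ht)).hasDerivAt (mem_interior_iff_mem_nhds.1 ht)
        have hgrow := (convex_Ici (0 : ℝ)).mul_sub_le_image_sub_of_le_deriv
          (hh.continuous.comp_continuousOn hx.continuousOn)
          (fun t ht => (hd t ht).differentiableAt.differentiableWithinAt) (C := φ (-c))
          (fun t ht => by
            have ht0 : 0 ≤ t := interior_subset ht
            rw [show deriv (h ∘ x) t = _ from (hd t ht).deriv]
            have h1 := hcon t ht0
            exact (hφ h1.le).trans (hdec _ (hmem t ht0) (by linarith)))
        have ht1 : 0 ≤ -h (x 0) / φ (-c) :=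
          div_nonneg (by have := hcon 0 le_rfl; linarith) hκ.le
        have h1 := hgrow 0 self_mem_Ici _ ht1 ht1
        rw [sub_zero, mul_div_cancel₀ _ hκ.ne'] at h1
        have h2 := hcon _ ht1
        simp only [Function.comp] at h1
        linarith
      obtain ⟨t₀, ht₀, hht₀⟩ := hreach
      filter_upwards [eventually_ge_atTop t₀] with t ht
      have hsub : Icc t₀ t ⊆ Ici 0 := fun s hs => ht₀.trans hs.1
      have h1 := (hx.mono hsub).le_of_forall_mem hh (fun s hs => hmem s (hsub hs)) hpos
        (neg_lt_zero.2 hc) hht₀ ht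
      have h2 : x t ∈ Metric.thickening ε (safeSet h) := by
        by_contra h3
        exact absurd (hcK _ (hmem t (ht₀.trans ht)) h3) (not_lt.2 h1)
      obtain ⟨z, hz, hzx⟩ := Metric.mem_thickening_iff.1 h2
      rw [Real.dist_eq, sub_zero, abs_of_nonneg Metric.infDist_nonneg]
      exact (Metric.infDist_le_dist_of_mem hz).trans_lt hzx

end Stability

/-! ### The quadratic program at a fixed state -/

section QuadraticProgram

variable {n m : ℕ}

lemma weightedSq_smul (Γ : Matrix (Fin m) (Fin m) ℝ) (a : ℝ) (u : EuclideanSpace ℝ (Fin m)) :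
    weightedSq Γ (a • u) = a ^ 2 * weightedSq Γ u := by
  simp only [weightedSq, Finset.mul_sum, PiLp.smul_apply, smul_eq_mul]
  exact Finset.sum_congr rfl fun i _ => Finset.sum_congr rfl fun j _ => by ring

lemma weightedSq_parallelogram (Γ : Matrix (Fin m) (Fin m) ℝ) (u v : EuclideanSpace ℝ (Fin m)) :
    weightedSq Γ (u + v) + weightedSq Γ (u - v) = 2 * (weightedSq Γ u + weightedSq Γ v) := by
  simp only [weightedSq, Finset.mul_sum, ← Finset.sum_add_distrib, PiLp.add_apply, PiLp.sub_apply]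
  exact Finset.sum_congr rfl fun i _ => Finset.sum_congr rfl fun j _ => by ring

lemma continuous_weightedSq (Γ : Matrix (Fin m) (Fin m) ℝ) : Continuous (weightedSq Γ) := by
  unfold weightedSq
  fun_prop

lemma weightedSq_pos {Γ : Matrix (Fin m) (Fin m) ℝ} (hΓ : Γ.PosDef)
    {u : EuclideanSpace ℝ (Fin m)} (hu : u ≠ 0) : 0 < weightedSq Γ u := by
  have h := hΓ.dotProduct_mulVec_pos (x := (u : Fin m → ℝ))
    (fun h0 => hu (by ext i; exact congrFun h0 i))
  simpa [weightedSq, dotProduct, Matrix.mulVec, Finset.mul_sum, mul_assoc] using h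

lemma exists_le_weightedSq {Γ : Matrix (Fin m) (Fin m) ℝ} (hΓ : Γ.PosDef) :
    ∃ c > 0, ∀ u : EuclideanSpace ℝ (Fin m), c * ‖u‖ ^ 2 ≤ weightedSq Γ u := by
  obtain ⟨c, hc, hcu⟩ := (isCompact_sphere (0 : EuclideanSpace ℝ (Fin m)) 1).exists_forall_le'
    (continuous_weightedSq Γ).continuousOn (a := 0)
    (fun u hu => weightedSq_pos hΓ (ne_zero_of_mem_unit_sphere ⟨u, hu⟩))
  refine ⟨c, hc, fun u => ?_⟩
  rcases eq_or_ne u 0 with rfl | hu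
  · simp [weightedSq]
  · have hu' : ‖u‖ ≠ 0 := norm_ne_zero_iff.2 hu
    have h1 := hcu (‖u‖⁻¹ • u) (by simp [norm_smul, hu'])
    rw [weightedSq_smul, inv_pow, inv_mul_eq_div, le_div_iff₀ (by positivity)] at h1
    exact h1

/-- The cost grows at least quadratically in the distance to its unconstrained minimizer. -/
lemma ODQPData.Admissible.exists_le_cost {d : ODQPData n m} (hd : d.Admissible) :
    ∃ c > 0, ∀ x q, c * ‖q - (d.kd x, d.θd)‖ ^ 2 ≤ d.cost x q := by
  obtain ⟨c, hc, hcu⟩ := exists_le_weightedSq hd.posDef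
  have hp := hd.p_pos
  refine ⟨min (c / 2) (d.p / 2), by positivity, fun x q => ?_⟩
  have h1 := hcu (q.1 - d.kd x)
  have h2 : 0 ≤ (q.2 - d.θd) ^ 2 := sq_nonneg _
  have h3 : 0 ≤ ‖q.1 - d.kd x‖ ^ 2 := sq_nonneg _
  have h4 := mul_nonneg hc.le h3
  have h5 := mul_nonneg hp.le h2
  rw [Prod.norm_def]
  simp only [Prod.fst_sub, Prod.snd_sub, ODQPData.cost]
  rcases max_choice ‖q.1 - d.kd x‖ ‖q.2 - d.θd‖ with h | h <;> rw [h]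
  · have := mul_le_mul_of_nonneg_right (min_le_left (c / 2) (d.p / 2)) h3
    linarith
  · rw [Real.norm_eq_abs, sq_abs]
    have := mul_le_mul_of_nonneg_right (min_le_right (c / 2) (d.p / 2)) h2
    linarith

/-- The cost is strictly midpoint convex. -/
lemma ODQPData.Admissible.cost_midpoint_lt {d : ODQPData n m} (hd : d.Admissible)
    (x : EuclideanSpace ℝ (Fin n)) {q q' : EuclideanSpace ℝ (Fin m) × ℝ} (hq : q ≠ q') :
    d.cost x ((1 / 2 : ℝ) • (q + q')) < (d.cost x q + d.cost x q') / 2 := by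
  have h1 := weightedSq_parallelogram d.Γ ((1 / 2 : ℝ) • (q.1 - d.kd x))
    ((1 / 2 : ℝ) • (q'.1 - d.kd x))
  rw [← smul_add, ← smul_sub, weightedSq_smul _ _ (q.1 - d.kd x),
    weightedSq_smul _ _ (q'.1 - d.kd x), weightedSq_smul _ _ (_ - _), sub_sub_sub_cancel_right] at h1
  have h2 : (1 / 2 : ℝ) • (q.1 - d.kd x + (q'.1 - d.kd x)) =
      (1 / 2 : ℝ) • (q.1 + q'.1) - d.kd x := by module
  rw [h2] at h1
  have hp := hd.p_pos
  have h3 : 0 < weightedSq d.Γ (q.1 - q'.1) + d.p * (q.2 - q'.2) ^ 2 := by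
    obtain ⟨c, hc, hcu⟩ := exists_le_weightedSq hd.posDef
    have h4 : 0 ≤ weightedSq d.Γ (q.1 - q'.1) := (hcu _).trans' (by positivity)
    by_cases h5 : q.1 = q'.1
    · have h6 : q.2 - q'.2 ≠ 0 := fun h6 => hq (Prod.ext h5 (sub_eq_zero.1 h6))
      positivity
    · have := weightedSq_pos hd.posDef (sub_ne_zero.2 h5)
      positivity
  simp only [ODQPData.cost, Prod.smul_fst, Prod.fst_add, Prod.smul_snd, Prod.snd_add, smul_eq_mul]
  nlinarith

lemma ODQPData.continuous_cost (d : ODQPData n m) (x : EuclideanSpace ℝ (Fin n)) :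
    Continuous (d.cost x) := by
  have := continuous_weightedSq d.Γ
  unfold ODQPData.cost
  fun_prop

variable {h : EuclideanSpace ℝ (Fin n) → ℝ}
  {f : EuclideanSpace ℝ (Fin n) → EuclideanSpace ℝ (Fin n)}
  {g : EuclideanSpace ℝ (Fin n) → EuclideanSpace ℝ (Fin m) →L[ℝ] EuclideanSpace ℝ (Fin n)}
  {d : ODQPData n m} {x : EuclideanSpace ℝ (Fin n)}

/-- The value of the barrier constraint of the quadratic program, which requires it to be
nonnegative. -/
noncomputable def ODQPData.barrierValue (d : ODQPData n m) (h : EuclideanSpace ℝ (Fin n) → ℝ)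
    (f : EuclideanSpace ℝ (Fin n) → EuclideanSpace ℝ (Fin n))
    (g : EuclideanSpace ℝ (Fin n) → EuclideanSpace ℝ (Fin m) →L[ℝ] EuclideanSpace ℝ (Fin n))
    (x : EuclideanSpace ℝ (Fin n)) (q : EuclideanSpace ℝ (Fin m) × ℝ) : ℝ :=
  lieDrift h f x + lieInput h g x q.1 + q.2 * d.α (h x)

lemma ODQPData.Admissible.mem_feasibleSet_iff (hd : d.Admissible)
    {q : EuclideanSpace ℝ (Fin m) × ℝ} :
    q ∈ d.feasibleSet h f g x ↔ 0 ≤ d.barrierValue h f g x q ∧ d.θd ≤ q.2 := by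
  simp only [ODQPData.feasibleSet, ODQPData.barrierValue, mem_ofPred_eq]
  constructor
  · rintro ⟨-, h1, h2⟩
    exact ⟨by linarith, h2⟩
  · rintro ⟨h1, h2⟩
    exact ⟨hd.θd_nonneg.trans h2, by linarith, h2⟩

/-- The barrier constraint is affine in the decision variables. -/
lemma ODQPData.barrierValue_combo (q q' : EuclideanSpace ℝ (Fin m) × ℝ) {a b : ℝ}
    (hab : a + b = 1) :
    d.barrierValue h f g x (a • q + b • q') =
      a * d.barrierValue h f g x q + b * d.barrierValue h f g x q' := by
  obtain rfl : b = 1 - a := by linarith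
  simp only [ODQPData.barrierValue, Prod.fst_add, Prod.snd_add, Prod.smul_fst, Prod.smul_snd,
    map_add, map_smul, smul_eq_mul]
  ring

lemma ODQPData.continuous_barrierValue : Continuous (d.barrierValue h f g x) := by
  unfold ODQPData.barrierValue
  fun_prop

lemma ODQPData.Admissible.isSolution_unique (hd : d.Admissible)
    {q q' : EuclideanSpace ℝ (Fin m) × ℝ} (hq : d.IsSolution h f g x q)
    (hq' : d.IsSolution h f g x q') : q = q' := by
  by_contra hne
  have h1 := hd.mem_feasibleSet_iff.1 hq.1
  have h2 := hd.mem_feasibleSet_iff.1 hq'.1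
  have hmid : (1 / 2 : ℝ) • (q + q') ∈ d.feasibleSet h f g x := by
    rw [smul_add, hd.mem_feasibleSet_iff, ODQPData.barrierValue_combo _ _ (by norm_num)]
    constructor
    · linarith [h1.1, h2.1]
    · simp only [Prod.snd_add, Prod.smul_snd, smul_eq_mul]
      linarith [h1.2, h2.2]
  have h3 := hd.cost_midpoint_lt x hne
  have h4 := hq.2 hmid
  have h5 := hq'.2 hmid
  simp only [mem_ofPred_eq] at h4 h5
  linarith

/-- A feasible quadratic program has a minimizer, because its cost is coercive. -/
lemma ODQPData.Admissible.exists_isSolution (hd : d.Admissible)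
    (hne : (d.feasibleSet h f g x).Nonempty) : ∃ q, d.IsSolution h f g x q := by
  obtain ⟨q₀, hq₀⟩ := hne
  obtain ⟨c, hc, hcost⟩ := hd.exists_le_cost
  have hclosed : IsClosed (d.feasibleSet h f g x) := by
    have : d.feasibleSet h f g x = {q | 0 ≤ d.barrierValue h f g x q} ∩ {q | d.θd ≤ q.2} := by
      ext q
      exact hd.mem_feasibleSet_iff
    rw [this]
    exact (isClosed_le continuous_const d.continuous_barrierValue).inter
      (isClosed_le continuous_const continuous_snd)
  have hcoer : Tendsto (fun q => c * ‖q - (d.kd x, d.θd)‖ ^ 2)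
      (cocompact (EuclideanSpace ℝ (Fin m) × ℝ)) atTop :=
    (((tendsto_pow_atTop two_ne_zero).comp ((tendsto_norm_cocompact_atTop).comp
      (Homeomorph.subRight (d.kd x, d.θd)).isClosedEmbedding.tendsto_cocompact)).const_mul_atTop hc)
  obtain ⟨q, hq, hmin⟩ := (d.continuous_cost x).continuousOn.exists_isMinOn' hclosed hq₀
    (((hcoer.eventually_ge_atTop (d.cost x q₀)).mono fun q hq => hq.trans (hcost x q)).filter_mono
      inf_le_left)
  exact ⟨q, hq, hmin⟩

/-! ### Feasibility -/

/-- Outside the safe set only the input can restore feasibility; this requires `L_g h x ≠ 0`. -/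
lemma ODQPData.Admissible.feasibleSet_nonempty_of_lieInput_ne_zero (hd : d.Admissible)
    (hx : lieInput h g x ≠ 0) : (d.feasibleSet h f g x).Nonempty := by
  obtain ⟨v, hv⟩ : ∃ v, lieInput h g x v ≠ 0 := by
    by_contra! hcon
    exact hx (ContinuousLinearMap.ext hcon)
  refine ⟨((-(lieDrift h f x + d.θd * d.α (h x)) / lieInput h g x v) • v, d.θd),
    hd.mem_feasibleSet_iff.2 ⟨?_, le_rfl⟩⟩
  simp only [ODQPData.barrierValue, map_smul, smul_eq_mul, div_mul_cancel₀ _ hv]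
  linarith

/-- On the safe set the quadratic program has a Slater point, for *every* choice of its data: where
`h x > 0` a large decay rate `ω` does it, and where `h x = 0` the term `ω α (h x)` vanishes for
every `α`, so that the class `𝒦ᵉ` function in the definition of an OD-CBF is irrelevant. -/
lemma IsODCBF.exists_barrierValue_pos (hcbf : IsODCBF h f g) (hd : d.Admissible)
    (hx : x ∈ safeSet h) : ∃ q, 0 < d.barrierValue h f g x q ∧ d.θd ≤ q.2 := by
  rcases (show 0 ≤ h x from hx).eq_or_lt with h0 | hpos
  · obtain ⟨α, hα, hsup⟩ := hcbf
    have h1 := hsup x hx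
    simp only [lt_iSup_iff, ← h0, hα.map_zero, mul_zero, add_zero] at h1
    obtain ⟨u, ω, hω, h1⟩ := h1
    refine ⟨(u, d.θd), ?_, le_rfl⟩
    simp only [ODQPData.barrierValue, ← h0, hd.classK.map_zero, mul_zero, add_zero]
    exact_mod_cast h1
  · have hα : 0 < d.α (h x) := hd.classK.map_zero ▸ hd.classK.strictMono hpos
    refine ⟨(0, max d.θd ((1 - lieDrift h f x) / d.α (h x))), ?_, le_max_left _ _⟩
    have h1 := (div_le_iff₀ hα).1 (le_max_right d.θd ((1 - lieDrift h f x) / d.α (h x)))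
    simp only [ODQPData.barrierValue, map_zero, add_zero]
    linarith

end QuadraticProgram

/-! ### Continuity of the optimal feedback -/

section Feedback

variable {n m : ℕ} {h : EuclideanSpace ℝ (Fin n) → ℝ}
  {f : EuclideanSpace ℝ (Fin n) → EuclideanSpace ℝ (Fin n)}
  {g : EuclideanSpace ℝ (Fin n) → EuclideanSpace ℝ (Fin m) →L[ℝ] EuclideanSpace ℝ (Fin n)}
  {d : ODQPData n m}

lemma ODQPData.Admissible.continuous_barrierValue_uncurry (hd : d.Admissible)
    (hh : ContDiff ℝ 1 h) (hf : Continuous f) (hg : Continuous g) :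
    Continuous fun z : EuclideanSpace ℝ (Fin n) × (EuclideanSpace ℝ (Fin m) × ℝ) =>
      d.barrierValue h f g z.1 z.2 := by
  have h1 : Continuous (fderiv ℝ h) := hh.continuous_fderiv one_ne_zero
  have h2 := hh.continuous
  have h3 := hd.classK.continuous
  simp only [ODQPData.barrierValue, lieDrift, lieInput, ContinuousLinearMap.comp_apply]
  fun_prop

lemma ODQPData.continuous_cost_uncurry (hkd : Continuous d.kd) :
    Continuous fun z : EuclideanSpace ℝ (Fin n) × (EuclideanSpace ℝ (Fin m) × ℝ) =>
      d.cost z.1 z.2 := by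
  have := continuous_weightedSq d.Γ
  simp only [ODQPData.cost]
  fun_prop

/-- A feasible point that does at least as well as every Slater point is a minimizer, provided that
a Slater point exists: the Slater points are then dense in the convex feasible set. -/
lemma ODQPData.Admissible.isSolution_of_forall_slater (hd : d.Admissible)
    {x : EuclideanSpace ℝ (Fin n)} (hslater : ∃ q, 0 < d.barrierValue h f g x q ∧ d.θd ≤ q.2)
    {q : EuclideanSpace ℝ (Fin m) × ℝ} (hq : q ∈ d.feasibleSet h f g x)
    (hle : ∀ w, 0 < d.barrierValue h f g x w → d.θd ≤ w.2 → d.cost x q ≤ d.cost x w) :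
    d.IsSolution h f g x q := by
  obtain ⟨w₀, hw₀, hw₀2⟩ := hslater
  refine ⟨hq, isMinOn_iff.2 fun w hw => ?_⟩
  have hw' := hd.mem_feasibleSet_iff.1 hw
  have hseg : Tendsto (fun t : ℝ => d.cost x ((1 - t) • w + t • w₀)) (𝓝[>] 0)
      (𝓝 (d.cost x w)) := by
    have h1 : Continuous fun t : ℝ => d.cost x ((1 - t) • w + t • w₀) :=
      (d.continuous_cost x).comp (by fun_prop)
    simpa using (h1.tendsto 0).mono_left nhdsWithin_le_nhds
  refine ge_of_tendsto hseg ?_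
  filter_upwards [Ioo_mem_nhdsGT (zero_lt_one' ℝ)] with t ht
  refine hle _ ?_ ?_
  · rw [ODQPData.barrierValue_combo _ _ (by ring)]
    exact add_pos_of_nonneg_of_pos (mul_nonneg (by linarith [ht.2]) hw'.1) (mul_pos ht.1 hw₀)
  · simp only [Prod.snd_add, Prod.smul_snd, smul_eq_mul]
    nlinarith [mul_le_mul_of_nonneg_left hw'.2 (by linarith [ht.2] : 0 ≤ 1 - t),
      mul_le_mul_of_nonneg_left hw₀2 ht.1.le]

/-- Decision variables whose cost is locally bounded above are themselves locally bounded, by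
coercivity of the cost. -/
lemma ODQPData.Admissible.exists_eventually_mem_closedBall (hd : d.Admissible)
    (hkd : Continuous d.kd) {x₀ : EuclideanSpace ℝ (Fin n)} {M : ℝ}
    {q : EuclideanSpace ℝ (Fin n) → EuclideanSpace ℝ (Fin m) × ℝ}
    (hq : ∀ᶠ x in 𝓝 x₀, d.cost x (q x) ≤ M) :
    ∃ R, ∀ᶠ x in 𝓝 x₀, q x ∈ Metric.closedBall 0 R := by
  obtain ⟨c, hc, hcost⟩ := hd.exists_le_cost
  refine ⟨M / c + 1 + (‖(d.kd x₀, d.θd)‖ + 1), ?_⟩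
  have h1 : Continuous fun x => ‖(d.kd x, d.θd)‖ := by fun_prop
  filter_upwards [hq, h1.continuousAt.eventually_lt_const (lt_add_one ‖(d.kd x₀, d.θd)‖)]
    with x h2 h4
  have h5 : ‖q x - (d.kd x, d.θd)‖ ^ 2 ≤ M / c := by
    rw [le_div_iff₀' hc]
    exact (hcost x (q x)).trans h2
  have h6 : ‖q x - (d.kd x, d.θd)‖ ≤ M / c + 1 := by
    nlinarith [sq_nonneg (‖q x - (d.kd x, d.θd)‖ - 1)]
  rw [mem_closedBall_zero_iff]
  have h7 := norm_le_norm_sub_add (q x) (d.kd x, d.θd)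
  linarith

/-- The minimizer of the quadratic program depends continuously on the state near a state with a
Slater point: a limit of minimizers is feasible and does at least as well as every Slater point. -/
theorem ODQPData.Admissible.continuousAt_of_isSolution (hd : d.Admissible) (hh : ContDiff ℝ 1 h)
    (hf : Continuous f) (hg : Continuous g) (hkd : Continuous d.kd)
    {x₀ : EuclideanSpace ℝ (Fin n)}
    (hslater : ∃ q, 0 < d.barrierValue h f g x₀ q ∧ d.θd ≤ q.2)
    {q : EuclideanSpace ℝ (Fin n) → EuclideanSpace ℝ (Fin m) × ℝ}
    (hq : ∀ᶠ x in 𝓝 x₀, d.IsSolution h f g x (q x)) : ContinuousAt q x₀ := by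
  have hB := hd.continuous_barrierValue_uncurry hh hf hg
  have hJ := d.continuous_cost_uncurry hkd
  have hJx : ∀ w, Continuous fun x => d.cost x w := fun w =>
    hJ.comp (f := fun x => (x, w)) (by fun_prop)
  have hBx : ∀ w, Continuous fun x => d.barrierValue h f g x w := fun w =>
    hB.comp (f := fun x => (x, w)) (by fun_prop)
  -- A Slater point at `x₀` remains feasible nearby.
  have hcompare : ∀ w, 0 < d.barrierValue h f g x₀ w → d.θd ≤ w.2 →
      ∀ᶠ x in 𝓝 x₀, d.cost x (q x) ≤ d.cost x w := fun w hw hw2 => by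
    filter_upwards [hq, (hBx w).continuousAt.eventually_const_lt hw] with x hx hxw
    exact isMinOn_iff.1 hx.2 w (hd.mem_feasibleSet_iff.2 ⟨hxw.le, hw2⟩)
  obtain ⟨R, hR⟩ : ∃ R, ∀ᶠ x in 𝓝 x₀, q x ∈ Metric.closedBall 0 R := by
    obtain ⟨w₀, hw₀, hw₀2⟩ := hslater
    refine hd.exists_eventually_mem_closedBall hkd (M := d.cost x₀ w₀ + 1) ?_
    filter_upwards [hcompare w₀ hw₀ hw₀2,
      (hJx w₀).continuousAt.eventually_lt_const (lt_add_one (d.cost x₀ w₀))] with x h2 h3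
    exact h2.trans h3.le
  rw [ContinuousAt, tendsto_iff_ultrafilter]
  intro U hU
  obtain ⟨q', -, hq'⟩ := (isCompact_closedBall (0 : EuclideanSpace ℝ (Fin m) × ℝ) R
    ).ultrafilter_le_nhds' (U.map q) (hU hR)
  have hq'lim : Tendsto q U (𝓝 q') := hq'
  have hpair : Tendsto (fun x => (x, q x)) U (𝓝 (x₀, q')) :=
    Tendsto.prodMk_nhds hU hq'lim
  have hBlim : Tendsto (fun x => d.barrierValue h f g x (q x)) U
      (𝓝 (d.barrierValue h f g x₀ q')) :=
    Tendsto.comp (f := fun x => (x, q x)) (g := fun z => d.barrierValue h f g z.1 z.2)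
      (hB.tendsto (x₀, q')) hpair
  have hJlim : Tendsto (fun x => d.cost x (q x)) U (𝓝 (d.cost x₀ q')) :=
    Tendsto.comp (f := fun x => (x, q x)) (g := fun z => d.cost z.1 z.2)
      (hJ.tendsto (x₀, q')) hpair
  have h2lim : Tendsto (fun x => (q x).2) U (𝓝 q'.2) := hq'lim.snd_nhds
  have hfeas : ∀ᶠ x in (U : Filter _), 0 ≤ d.barrierValue h f g x (q x) ∧ d.θd ≤ (q x).2 := by
    filter_upwards [hU hq] with x hx
    exact hd.mem_feasibleSet_iff.1 hx.1
  have hq'sol : d.IsSolution h f g x₀ q' :=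
    hd.isSolution_of_forall_slater hslater
      (hd.mem_feasibleSet_iff.2 ⟨ge_of_tendsto hBlim (hfeas.mono fun _ hx => hx.1),
        ge_of_tendsto h2lim (hfeas.mono fun _ hx => hx.2)⟩)
      fun w hw hw2 => le_of_tendsto_of_tendsto hJlim (((hJx w).tendsto x₀).mono_left hU)
        (hU (hcompare w hw hw2))
  rw [hd.isSolution_unique hq.self_of_nhds hq'sol]
  exact hq'lim

end Feedback

/-! ### The safe set under optimal-decay feedback -/

theorem mainTheorem7 {n m : ℕ} (h : EuclideanSpace ℝ (Fin n) → ℝ)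
    (f : EuclideanSpace ℝ (Fin n) → EuclideanSpace ℝ (Fin n))
    (g : EuclideanSpace ℝ (Fin n) → EuclideanSpace ℝ (Fin m) →L[ℝ] EuclideanSpace ℝ (Fin n))
    (hh : ContDiff ℝ 1 h) (hf : LocallyLipschitz f) (hg : LocallyLipschitz g)
    (hcbf : IsODCBF h f g)
    (E : Set (EuclideanSpace ℝ (Fin n))) (hE : safeSet h ⊆ E)
    (hLg : ∀ x ∈ E \ safeSet h, lieInput h g x ≠ 0)
    (d : ODQPData n m) (hd : d.Admissible) :
    (∀ x ∈ E, (d.feasibleSet h f g x).Nonempty ∧ ∃! q, d.IsSolution h f g x q) ∧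
    (IsCompact (safeSet h) → 0 < d.θd → Continuous d.kd →
      ∀ (k : EuclideanSpace ℝ (Fin n) → EuclideanSpace ℝ (Fin m))
        (θ : EuclideanSpace ℝ (Fin n) → ℝ),
        (∀ᶠ x in 𝓝ˢ (safeSet h), (d.feasibleSet h f g x).Nonempty →
          d.IsSolution h f g x (k x, θ x)) →
        IsAsymptoticallyStable (fun x => f x + g x (k x)) (safeSet h)) := by
  constructor
  · intro x hx
    have hne : (d.feasibleSet h f g x).Nonempty := by
      by_cases hxC : x ∈ safeSet h
      · obtain ⟨q, hq, hq2⟩ := hcbf.exists_barrierValue_pos hd hxC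
        exact ⟨q, hd.mem_feasibleSet_iff.2 ⟨hq.le, hq2⟩⟩
      · exact hd.feasibleSet_nonempty_of_lieInput_ne_zero (hLg x ⟨hx, hxC⟩)
    obtain ⟨q, hq⟩ := hd.exists_isSolution hne
    exact ⟨hne, q, hq, fun q' hq' => hd.isSolution_unique hq' hq⟩
  · intro hC hθ hkd k θ hsol
    -- The states with a Slater point form an open set, which contains the safe set.
    let S : Set (EuclideanSpace ℝ (Fin n)) := {x | ∃ q, 0 < d.barrierValue h f g x q ∧ d.θd ≤ q.2}
    have hSopen : IsOpen S := by
      refine isOpen_iff_mem_nhds.2 fun x ⟨q, hq, hq2⟩ => ?_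
      have h1 : Continuous fun y => d.barrierValue h f g y q :=
        (hd.continuous_barrierValue_uncurry hh hf.continuous hg.continuous).comp
          (continuous_id.prodMk continuous_const)
      filter_upwards [h1.continuousAt.eventually_const_lt hq] with y hy
      exact ⟨q, hy, hq2⟩
    have hSC : S ∈ 𝓝ˢ (safeSet h) :=
      hSopen.mem_nhdsSet.2 fun x hx => hcbf.exists_barrierValue_pos hd hx
    obtain ⟨V, hVopen, hCV, hV⟩ := mem_nhdsSet_iff_exists.1 (inter_mem hSC hsol)
    have hVsol : ∀ x ∈ V, d.IsSolution h f g x (k x, θ x) := fun x hx => by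
      obtain ⟨q, hq, hq2⟩ := (hV hx).1
      exact (hV hx).2 ⟨q, hd.mem_feasibleSet_iff.2 ⟨hq.le, hq2⟩⟩
    obtain ⟨r, hr, hrV⟩ := hC.exists_cthickening_subset_open hVopen hCV
    refine isAsymptoticallyStable_safeSet (φ := fun s => -(d.θd * d.α s)) hh hC hr ?_ ?_ ?_ ?_
    · intro x hx
      have h1 : ContinuousAt (fun y => (k y, θ y)) x :=
        hd.continuousAt_of_isSolution hh hf.continuous hg.continuous hkd (hV (hrV hx)).1
          (eventually_of_mem (hVopen.mem_nhds (hrV hx)) hVsol)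
      exact (hf.continuous.continuousAt.add
        (hg.continuous.continuousAt.clm_apply h1.fst)).continuousWithinAt
    · exact fun s t hst => neg_le_neg
        (mul_le_mul_of_nonneg_left (hd.classK.strictMono.monotone hst) hθ.le)
    · intro s hs
      have h1 : d.α s < 0 := hd.classK.map_zero ▸ hd.classK.strictMono hs
      exact neg_pos.2 (mul_neg_of_pos_of_neg hθ h1)
    · intro x hx hx0
      obtain ⟨h1, h2⟩ := hd.mem_feasibleSet_iff.1 (hVsol x (hrV hx)).1
      have h3 : d.α (h x) < 0 := hd.classK.map_zero ▸ hd.classK.strictMono hx0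
      -- As `α (h x) < 0`, the constraint `θ x ≥ θd` turns into a lower bound for `-θ x α (h x)`.
      have h4 : θ x * d.α (h x) ≤ d.θd * d.α (h x) := mul_le_mul_of_nonpos_right h2 h3.le
      simp only [ODQPData.barrierValue, lieDrift, lieInput, ContinuousLinearMap.comp_apply] at h1
      simp only [map_add]
      linarith
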